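/- Let $B_3=\langle\sigma_1,\sigma_2\mid\sigma_1\sigma_2\sigma_1=\sigma_2\sigma_1\sigma_2\rangle$ be the 3-strand braid group and let $B_t\colon B_3\to \mathrm{GL}_2(\mathbb{Z}[t^{\pm1}])$ be its reduced Burau representation, given by $$B_t(\sigma_1)=\begin{pmatrix}-t&1\\0&1\end{pmatrix},\qquad B_t(\sigma_2)=\begin{pmatrix}1&0\\t&-t\end{pmatrix}.$$ For $w\in B_3$ let $\#w\in\mathbb{Z}$ be its image under the homomorphism $B_3\to\mathbb{Z}$ sending each $\sigma_i$ to $1$, and for $t\in\mathbb{C}\setminus\{0\}$ let $\rho_w(t)$ be the spectral radius (the largest absolute value of an eigenvalue) of the complex matrix $B_t(w)$. If $w$ is positive, that is, a product of the generators $\sigma_1,\sigma_2$ without inverses, the entries of $B_t(w)$ are polynomials in $t$, and $\rho_w(0)$ is defined in the same way. **Theorem.** Let $w\in B_3$ be a positive braid whose braid closure $\widehat w\subset S^3$ is a knot. Then $\rho_w(0)=0$, $\rho_w(1)=1$, and $\rho_w(t)<1$ for all real $t\in[0,1)$. Moreover, there is an $\epsilon>0$ such that $\rho_w(t)=t^{\#w/2}$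 for all real $t\in(1-\epsilon,1+\epsilon)$. -/

import Mathlib

open scoped LaurentPolynomial ContDiff

set_option linter.unusedSimpArgs false

noncomputable section

/-- The single defining relation `σ₁ σ₂ σ₁ = σ₂ σ₁ σ₂`; `0` stands for `σ₁` and `1` for `σ₂`. -/
def braidRels : Set (FreeGroup (Fin 2)) :=
  {FreeGroup.of 0 * FreeGroup.of 1 * FreeGroup.of 0 *
    (FreeGroup.of 1 * FreeGroup.of 0 * FreeGroup.of 1)⁻¹}

/-- The braid group on three strands. -/
abbrev Braid3 : Type := PresentedGroup braidRels

/-- The standard generators: `braidGen 0 = σ₁` and `braidGen 1 = σ₂`. -/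
def braidGen (i : Fin 2) : Braid3 := PresentedGroup.of i

/-- A braid is positive if it is a product of the generators `σ₁`, `σ₂` (no inverses). -/
def IsPositiveBraid (w : Braid3) : Prop :=
  w ∈ Submonoid.closure (Set.range braidGen)

/-- The homomorphism from the braid group to `ℤ` that sends each generator to `1`. -/
def exponentHom : Braid3 →* Multiplicative ℤ :=
  PresentedGroup.toGroup (rels := braidRels) (f := fun _ => Multiplicative.ofAdd 1) (by
    intro r hr
    rw [braidRels, Set.mem_singleton_iff] at hr
    subst hr
    simp)

/-- The exponent sum `#w`. -/
def exponentSum (w : Braid3) : ℤ := Multiplicative.toAdd (exponentHom w)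

/-! ### The reduced Burau representation -/

theorem T_mul_T_neg : (LaurentPolynomial.T 1 * LaurentPolynomial.T (-1) : ℤ[T;T⁻¹]) = 1 := by
  rw [← LaurentPolynomial.T_add, add_neg_cancel, LaurentPolynomial.T_zero]

theorem T_neg_mul_T : (LaurentPolynomial.T (-1) * LaurentPolynomial.T 1 : ℤ[T;T⁻¹]) = 1 := by
  rw [← LaurentPolynomial.T_add, neg_add_cancel, LaurentPolynomial.T_zero]

/-- The Burau matrix of `σ₁`, with its inverse. -/
def burauSigma1 : GL (Fin 2) ℤ[T;T⁻¹] where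
  val := !![-LaurentPolynomial.T 1, 1; 0, 1]
  inv := !![-LaurentPolynomial.T (-1), LaurentPolynomial.T (-1); 0, 1]
  val_inv := by
    rw [Matrix.mul_fin_two, Matrix.one_fin_two]
    simp only [neg_mul_neg, T_mul_T_neg, T_neg_mul_T, mul_zero, zero_mul, mul_one, one_mul,
      add_zero, zero_add, neg_mul, mul_neg, neg_add_cancel, add_neg_cancel, neg_neg, neg_zero]
  inv_val := by
    rw [Matrix.mul_fin_two, Matrix.one_fin_two]
    simp only [neg_mul_neg, T_mul_T_neg, T_neg_mul_T, mul_zero, zero_mul, mul_one, one_mul,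
      add_zero, zero_add, neg_mul, mul_neg, neg_add_cancel, add_neg_cancel, neg_neg, neg_zero]

/-- The Burau matrix of `σ₂`, with its inverse. -/
def burauSigma2 : GL (Fin 2) ℤ[T;T⁻¹] where
  val := !![1, 0; LaurentPolynomial.T 1, -LaurentPolynomial.T 1]
  inv := !![1, 0; 1, -LaurentPolynomial.T (-1)]
  val_inv := by
    rw [Matrix.mul_fin_two, Matrix.one_fin_two]
    simp only [neg_mul_neg, T_mul_T_neg, T_neg_mul_T, mul_zero, zero_mul, mul_one, one_mul,
      add_zero, zero_add, neg_mul, mul_neg, neg_add_cancel, add_neg_cancel, neg_neg, neg_zero]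
  inv_val := by
    rw [Matrix.mul_fin_two, Matrix.one_fin_two]
    simp only [neg_mul_neg, T_mul_T_neg, T_neg_mul_T, mul_zero, zero_mul, mul_one, one_mul,
      add_zero, zero_add, neg_mul, mul_neg, neg_add_cancel, add_neg_cancel, neg_neg, neg_zero]

theorem burau_relation {R : Type*} [CommRing R] (a : R) :
    !![-a, 1; 0, 1] * !![1, 0; a, -a] * !![-a, 1; 0, 1] =
      !![1, 0; a, -a] * !![-a, 1; 0, 1] * !![1, 0; a, -a] := by
  simp only [Matrix.mul_fin_two]
  congr 2
  · congr 1
    · ring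
    · congr 1
      ring
  · congr 2
    · ring
    · congr 1
      ring

/-- The reduced Burau representation of the three-strand braid group. -/
def burau : Braid3 →* GL (Fin 2) ℤ[T;T⁻¹] :=
  PresentedGroup.toGroup (rels := braidRels) (f := ![burauSigma1, burauSigma2]) (by
    intro r hr
    rw [braidRels, Set.mem_singleton_iff] at hr
    subst hr
    simp only [map_mul, map_inv, FreeGroup.lift_apply_of, Matrix.cons_val_zero,
      Matrix.cons_val_one, mul_inv_eq_one]
    exact Units.ext (burau_relation _))

/-- The value of a Laurent polynomial at a complex number `t`, namely `∑ aₙ tⁿ`. At `t = 0` this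
is the constant coefficient, which is the value at `0` whenever no negative power occurs. -/
def laurentValue (t : ℂ) (f : ℤ[T;T⁻¹]) : ℂ :=
  f.coeff.sum fun n a => (a : ℂ) * t ^ n

/-- The matrix `B_t(w)` at a complex number `t`. -/
def burauAt (w : Braid3) (t : ℂ) : Matrix (Fin 2) (Fin 2) ℂ :=
  (burau w).val.map (laurentValue t)

/-- The spectral radius `ρ_w(t)` of `B_t(w)`. It is meaningful for `t ≠ 0`, and for positive `w`
also at `t = 0`, since then the entries of the Burau matrix are polynomials. -/
def rho (w : Braid3) (t : ℂ) : ℝ :=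
  (spectralRadius ℂ (burauAt w t)).toReal

/-! ### Closed braids in the three-sphere -/

/-- The three points in which the geometric crossing `σ₁^{±1}` or `σ₂^{±1}` meets the plane at
height `x ∈ [0, 1]`. The strands start and end at `1, 2, 3`; two adjacent ones turn half way
around each other, counterclockwise for a generator (`true`) and clockwise for an inverse
(`false`), and the third one is fixed. -/
def crossingSlice (a : Fin 2 × Bool) (x : ℝ) : Set ℂ :=
  let u : ℂ := Complex.exp
    ((if a.2 then 1 else -1) * (Real.pi * Real.smoothTransition x : ℝ) * Complex.I)
  if a.1 = 0 then {3 / 2 - u / 2, 3 / 2 + u / 2, 3} else {1, 5 / 2 - u / 2, 5 / 2 + u / 2}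

/-- The slice at height `s` of the geometric braid of the word `l`: the `k`-th crossing occupies
the heights `[k, k + 1]`, and above the last crossing there are three vertical strands. -/
def braidSlice (l : List (Fin 2 × Bool)) (s : ℝ) : Set ℂ :=
  match l[⌊s⌋₊]? with
  | some a => crossingSlice a (Int.fract s)
  | none => {1, 2, 3}

/-- The closure of the geometric braid of the word `l`, which has height `l.length + 1`, as a
subset of the unit sphere of `ℂ²`: the open solid torus (unit disc) × circle is embedded there
by `(z, θ) ↦ (z, √(1 - |z|²) exp (i θ))`. -/
def closedBraid (l : List (Fin 2 × Bool)) : Set (EuclideanSpace ℂ (Fin 2)) :=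
  {P | ∃ s ∈ Set.Icc (0 : ℝ) (l.length + 1), ∃ p ∈ braidSlice l s,
    P = !₂[p / 4, (Real.sqrt (1 - ‖p / 4‖ ^ 2) : ℂ) *
      Complex.exp ((2 * Real.pi * s / (l.length + 1) : ℝ) * Complex.I)]}

/-- A set is a knot if it is the image of a smooth embedding of the circle `ℝ / ℤ` into the
three-sphere, here the unit sphere of `ℂ²`. -/
def IsKnot (L : Set (EuclideanSpace ℂ (Fin 2))) : Prop :=
  ∃ γ : ℝ → EuclideanSpace ℂ (Fin 2),
    ContDiff ℝ ∞ γ ∧ (∀ x, deriv γ x ≠ 0) ∧ (∀ x, γ x ∈ Metric.sphere 0 1) ∧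
    (∀ x y, γ x = γ y ↔ ∃ n : ℤ, y = x + n) ∧ Set.range γ = L

/-- The braid closure of `w` is a knot. The closures of any two words that represent `w` are
isotopic, so it does not matter which word is taken. -/
def ClosureIsKnot (w : Braid3) : Prop :=
  ∃ l : List (Fin 2 × Bool),
    PresentedGroup.mk braidRels (FreeGroup.mk l) = w ∧ IsKnot (closedBraid l)

end

/-! Only two things about the knot matter: its closure is connected, and so the permutation of `w`
on three points has no fixed point (`ClosureIsKnot.braidPerm_ne`); a strand returning to its start
would close up to a component disjoint from the rest. The knot hypothesis may use a word with
inverses, but the permutation depends on `w` alone, so it passes to a positive word `l` for `w`. It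
is a 3-cycle, so `l` contains both generators and has even length.

For `0 ≤ t ≤ 1`, a row vector `(a - b, b - c)` records a triple up to translation, and each Burau
matrix replaces the three points by convex combinations of them, so the diameter `hexNorm` does not
grow. The product `σ₁σ₂` scales it by exactly `t`. Since `σ₁σ₂` occurs in `l ++ l`, every eigenvalue
satisfies `‖z‖ ^ 2 ≤ t` (`norm_sq_le_of_mem_spectrum_burauWord`). This gives the claims at `0` and
on `[0, 1)`.

At `t = 1` the matrix is the reduced permutation matrix of a 3-cycle, with trace `-1` and
determinant `1`. The discriminant `-3` stays negative nearby, where the eigenvalues are complex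
conjugates with product `t ^ l.length` (`exists_norm_eq_of_mem_spectrum`). -/

noncomputable section

/-! ### Evaluation of the Burau matrices of positive words -/

/-- The Burau matrix of a generator over an arbitrary commutative ring. -/
def burauMat {R : Type*} [CommRing R] (t : R) (i : Fin 2) : Matrix (Fin 2) (Fin 2) R :=
  if i = 0 then !![-t, 1; 0, 1] else !![1, 0; t, -t]

/-- The Burau matrix of a positive word over an arbitrary commutative ring. -/
def burauWord {R : Type*} [CommRing R] (t : R) (l : List (Fin 2)) : Matrix (Fin 2) (Fin 2) R :=
  (l.map (burauMat t)).prod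

theorem burauWord_cons {R : Type*} [CommRing R] (t : R) (i : Fin 2) (l : List (Fin 2)) :
    burauWord t (i :: l) = burauMat t i * burauWord t l := by
  simp [burauWord]

theorem burauWord_append {R : Type*} [CommRing R] (t : R) (l l' : List (Fin 2)) :
    burauWord t (l ++ l') = burauWord t l * burauWord t l' := by
  simp [burauWord]

theorem burauWord_map {R S : Type*} [CommRing R] [CommRing S] (f : R →+* S) (t : R)
    (l : List (Fin 2)) : (burauWord t l).map f = burauWord (f t) l := by
  induction l with
  | nil => simp [burauWord]
  | cons i l ih =>
    rw [burauWord_cons, burauWord_cons, Matrix.map_mul, ih]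
    congr 1
    ext a b
    fin_cases i <;> fin_cases a <;> fin_cases b <;> simp [burauMat]

theorem det_burauWord {R : Type*} [CommRing R] (t : R) (l : List (Fin 2)) :
    (burauWord t l).det = (-t) ^ l.length := by
  induction l with
  | nil => simp [burauWord]
  | cons i l ih =>
    rw [burauWord_cons, Matrix.det_mul, ih, List.length_cons, pow_succ']
    congr 1
    fin_cases i <;> simp [burauMat, Matrix.det_fin_two]

/-- At `t = 0` the function `laurentValue` is not multiplicative on Laurent polynomials, so
evaluation has to pass through honest polynomials, where it is a ring homomorphism. -/
theorem laurentValue_toLaurent (t : ℂ) (p : Polynomial ℤ) :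
    laurentValue t (Polynomial.toLaurent p) = Polynomial.eval₂ (Int.castRingHom ℂ) t p := by
  induction p using Polynomial.induction_on' with
  | add p q hp hq =>
    rw [map_add, Polynomial.eval₂_add, ← hp, ← hq]
    simp only [laurentValue, AddMonoidAlgebra.coeff_add]
    exact Finsupp.sum_add_index' (by simp) (by intros; push_cast; ring)
  | monomial n a =>
    rw [Polynomial.eval₂_monomial, ← Polynomial.C_mul_X_pow_eq_monomial,
      Polynomial.toLaurent_C_mul_X_pow, ← LaurentPolynomial.single_eq_C_mul_T, laurentValue,
      AddMonoidAlgebra.coeff_single, Finsupp.sum_single_index (by simp)]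
    simp

theorem burau_braidGen (i : Fin 2) :
    (burau (braidGen i)).val = burauMat (LaurentPolynomial.T 1) i := by
  rw [burau, braidGen, PresentedGroup.toGroup.of]
  fin_cases i <;> rfl

theorem burauAt_prod (l : List (Fin 2)) (t : ℂ) :
    burauAt (l.map braidGen).prod t = burauWord t l := by
  have h : (burau (l.map braidGen).prod).val = burauWord (LaurentPolynomial.T 1) l := by
    induction l with
    | nil => simp [burauWord]
    | cons i l ih =>
      rw [List.map_cons, List.prod_cons, map_mul, Units.val_mul, ih, burau_braidGen,
        burauWord_cons]
  rw [burauAt, h, ← Polynomial.toLaurent_X, ← burauWord_map, Matrix.map_map]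
  have := burauWord_map (Polynomial.eval₂RingHom (Int.castRingHom ℂ) t) Polynomial.X l
  rw [Polynomial.coe_eval₂RingHom, Polynomial.eval₂_X] at this
  rw [← this]
  congr 1
  ext p
  exact laurentValue_toLaurent t p

theorem IsPositiveBraid.exists_word {w : Braid3} (h : IsPositiveBraid w) :
    ∃ l : List (Fin 2), w = (l.map braidGen).prod := by
  induction h using Submonoid.closure_induction with
  | mem x hx =>
    obtain ⟨i, rfl⟩ := hx
    exact ⟨[i], by simp⟩
  | one => exact ⟨[], by simp⟩
  | mul x y _ _ hx hy =>
    obtain ⟨l, rfl⟩ := hx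
    obtain ⟨l', rfl⟩ := hy
    exact ⟨l ++ l', by simp⟩

theorem exponentSum_prod (l : List (Fin 2)) :
    exponentSum (l.map braidGen).prod = l.length := by
  induction l with
  | nil => simp [exponentSum]
  | cons i l ih =>
    rw [exponentSum] at ih ⊢
    rw [List.map_cons, List.prod_cons, map_mul, toAdd_mul, ih, exponentHom, braidGen,
      PresentedGroup.toGroup.of]
    simp [add_comm]

/-! ### The spectral radius of a complex `2 × 2` matrix -/

theorem toReal_spectralRadius_le {M : Matrix (Fin 2) (Fin 2) ℂ} {c : ℝ} (hc : 0 ≤ c)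
    (h : ∀ z ∈ spectrum ℂ M, ‖z‖ ≤ c) : (spectralRadius ℂ M).toReal ≤ c := by
  refine ENNReal.toReal_le_of_le_ofReal hc (iSup₂_le fun z hz => ?_)
  change ‖z‖ₑ ≤ _
  rw [← ofReal_norm]
  exact ENNReal.ofReal_le_ofReal (h z hz)

theorem toReal_spectralRadius_eq {M : Matrix (Fin 2) (Fin 2) ℂ} {c : ℝ} (hc : 0 ≤ c)
    (h : ∀ z ∈ spectrum ℂ M, ‖z‖ = c) : (spectralRadius ℂ M).toReal = c := by
  have : spectralRadius ℂ M = ENNReal.ofReal c := by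
    refine le_antisymm (iSup₂_le fun z hz => ?_) ?_
    · change ‖z‖ₑ ≤ _
      rw [← ofReal_norm, h z hz]
    -- The lower bound needs a spectral value to exist at all.
    · obtain ⟨z, hz⟩ := spectrum.nonempty_of_isAlgClosed_of_finiteDimensional ℂ M
      refine le_iSup₂_of_le z hz ?_
      change _ ≤ ‖z‖ₑ
      rw [← ofReal_norm, h z hz]
  rw [this, ENNReal.toReal_ofReal hc]

theorem exists_vecMul_of_mem_spectrum {M : Matrix (Fin 2) (Fin 2) ℂ} {z : ℂ}
    (hz : z ∈ spectrum ℂ M) : ∃ v ≠ 0, Matrix.vecMul v M = z • v := by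
  rw [spectrum.mem_iff, Matrix.isUnit_iff_isUnit_det, isUnit_iff_ne_zero, not_not] at hz
  obtain ⟨v, hv, h⟩ := Matrix.exists_vecMul_eq_zero_iff.2 hz
  refine ⟨v, hv, ?_⟩
  rw [Matrix.vecMul_sub, sub_eq_zero, Algebra.algebraMap_eq_smul_one, Matrix.vecMul_smul,
    Matrix.vecMul_one] at h
  exact h.symm

theorem charpoly_of_mem_spectrum {M : Matrix (Fin 2) (Fin 2) ℂ} {z : ℂ}
    (hz : z ∈ spectrum ℂ M) : z ^ 2 - M.trace * z + M.det = 0 := by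
  rw [spectrum.mem_iff, Matrix.isUnit_iff_isUnit_det, isUnit_iff_ne_zero, not_not] at hz
  rw [Matrix.det_fin_two] at hz ⊢
  simp [Matrix.algebraMap_matrix_apply] at hz
  rw [Matrix.trace_fin_two]
  linear_combination hz

/-- Negative discriminant forces `z` off the real line; the imaginary part of the equation then
gives `2 * z.re = a`, and the real part becomes `‖z‖ ^ 2 = b`. -/
theorem norm_of_quadratic {a b : ℝ} {z : ℂ} (h : z ^ 2 - a * z + b = 0) (hab : a ^ 2 < 4 * b) :
    ‖z‖ = √b := by
  have hre := congrArg Complex.re h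
  have him := congrArg Complex.im h
  simp [pow_two] at hre him
  have hy : z.im ≠ 0 := by
    intro hy
    rw [hy] at hre
    nlinarith [sq_nonneg (2 * z.re - a)]
  have hx : 2 * z.re = a := by
    apply mul_right_cancel₀ hy
    linarith
  rw [Complex.norm_def, Complex.normSq_apply]
  congr 1
  subst hx
  linarith

/-! ### Contraction of the hexagonal norm -/

/-- The norm `max (|x|, |y|, |x + y|)`: if `x = a - b` and `y = b - c`, it is the diameter
of `{a, b, c}`. -/
def hexNorm (v : Fin 2 → ℂ) : ℝ := max (max ‖v 0‖ ‖v 1‖) ‖v 0 + v 1‖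

theorem hexNorm_smul (z : ℂ) (v : Fin 2 → ℂ) : hexNorm (z • v) = ‖z‖ * hexNorm v := by
  simp [hexNorm, ← mul_add, mul_max_of_nonneg]

theorem hexNorm_pos {v : Fin 2 → ℂ} (hv : v ≠ 0) : 0 < hexNorm v := by
  by_contra! h
  apply hv
  simp only [hexNorm, max_le_iff, norm_le_zero_iff] at h
  ext i
  fin_cases i
  · exact h.1.1
  · exact h.1.2

theorem norm_segment_le {t B : ℝ} (h0 : 0 ≤ t) (h1 : t ≤ 1) {x y : ℂ} (hx : ‖x‖ ≤ B)
    (hy : ‖y‖ ≤ B) : ‖(1 - t : ℂ) * x + t * y‖ ≤ B := by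
  have h2 : ‖(1 - t : ℂ)‖ = 1 - t := by
    rw [← Complex.ofReal_one, ← Complex.ofReal_sub, Complex.norm_of_nonneg (by linarith)]
  calc _ ≤ (1 - t) * ‖x‖ + t * ‖y‖ := by
        refine (norm_add_le _ _).trans_eq ?_
        rw [norm_mul, norm_mul, h2, Complex.norm_of_nonneg h0]
    _ ≤ (1 - t) * B + t * B := by gcongr
    _ = B := by ring

theorem vecMul_burauMat_zero (t : ℂ) (v : Fin 2 → ℂ) :
    Matrix.vecMul v (burauMat t 0) = ![-t * v 0, v 0 + v 1] := by
  ext j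
  fin_cases j <;> simp [burauMat, Matrix.vecMul, dotProduct, Fin.sum_univ_two, mul_comm]

theorem vecMul_burauMat_one (t : ℂ) (v : Fin 2 → ℂ) :
    Matrix.vecMul v (burauMat t 1) = ![v 0 + t * v 1, -t * v 1] := by
  ext j
  fin_cases j <;> simp [burauMat, Matrix.vecMul, dotProduct, Fin.sum_univ_two, mul_comm]

/-- On triples, `σ₁` is `(a, b, c) ↦ ((1 - t) a + t b, a, c)` and `σ₂` is `(a, b, c) ↦ (a, (1 - t) b
+ t c, b)`. The new points lie in the convex hull of the old ones. Each new difference is therefore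
an old one or a convex combination of old ones, up to sign and including `0`. -/
theorem hexNorm_vecMul_burauMat_le {t : ℝ} (h0 : 0 ≤ t) (h1 : t ≤ 1) (i : Fin 2)
    (v : Fin 2 → ℂ) : hexNorm (Matrix.vecMul v (burauMat (t : ℂ) i)) ≤ hexNorm v := by
  have ha : ‖v 0‖ ≤ hexNorm v := (le_max_left _ _).trans (le_max_left _ _)
  have hb : ‖v 1‖ ≤ hexNorm v := (le_max_right _ _).trans (le_max_left _ _)
  have hc : ‖v 0 + v 1‖ ≤ hexNorm v := le_max_right _ _
  have hz : ‖(0 : ℂ)‖ ≤ hexNorm v := by simpa using (norm_nonneg _).trans ha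
  rcases Fin.exists_fin_two.1 ⟨i, rfl⟩ with rfl | rfl
  · have e1 := norm_segment_le h0 h1 hz ((norm_neg (v 0)).trans_le ha)
    have e2 := norm_segment_le h0 h1 hc hb
    rw [vecMul_burauMat_zero]
    refine max_le (max_le ?_ hc) ?_
    · rwa [mul_zero, zero_add, mul_neg, ← neg_mul] at e1
    · rw [show (1 - t : ℂ) * (v 0 + v 1) + t * v 1 = -t * v 0 + (v 0 + v 1) by ring] at e2
      exact e2
  · have e1 := norm_segment_le h0 h1 ha hc
    have e2 := norm_segment_le h0 h1 hz ((norm_neg (v 1)).trans_le hb)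
    rw [vecMul_burauMat_one]
    refine max_le (max_le ?_ ?_) ?_
    · rw [show (1 - t : ℂ) * v 0 + t * (v 0 + v 1) = v 0 + t * v 1 by ring] at e1
      exact e1
    · rwa [mul_zero, zero_add, mul_neg, ← neg_mul] at e2
    · rw [show v 0 = v 0 + t * v 1 + -t * v 1 by ring] at ha
      exact ha

theorem hexNorm_vecMul_burauWord_le {t : ℝ} (h0 : 0 ≤ t) (h1 : t ≤ 1) (l : List (Fin 2))
    (v : Fin 2 → ℂ) : hexNorm (Matrix.vecMul v (burauWord (t : ℂ) l)) ≤ hexNorm v := by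
  induction l generalizing v with
  | nil => simp [burauWord]
  | cons i l ih =>
    rw [burauWord_cons, ← Matrix.vecMul_vecMul]
    exact (ih _).trans (hexNorm_vecMul_burauMat_le h0 h1 i v)

/-- Up to sign, `σ₁σ₂` permutes the three differences `x`, `y`, `x + y` cyclically and multiplies
each by `t`. -/
theorem hexNorm_vecMul_burauWord_zero_one {t : ℝ} (h0 : 0 ≤ t) (v : Fin 2 → ℂ) :
    hexNorm (Matrix.vecMul v (burauWord (t : ℂ) [0, 1])) = t * hexNorm v := by
  have e0 : Matrix.vecMul v (burauWord (t : ℂ) [0, 1]) 0 = t * v 1 := by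
    simp [burauWord, burauMat, Matrix.vecMul, dotProduct, Fin.sum_univ_two]
    ring
  have e1 : Matrix.vecMul v (burauWord (t : ℂ) [0, 1]) 1 = t * -(v 0 + v 1) := by
    simp [burauWord, burauMat, Matrix.vecMul, dotProduct, Fin.sum_univ_two]
    ring
  have e2 : (t * v 1 + t * -(v 0 + v 1) : ℂ) = t * -v 0 := by ring
  rw [hexNorm, e0, e1, e2]
  simp only [norm_mul, norm_neg, Complex.norm_of_nonneg h0, hexNorm]
  rw [← mul_max_of_nonneg _ _ h0, ← mul_max_of_nonneg _ _ h0, max_comm (max _ _) ‖v 0‖,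
    ← max_assoc]

theorem exists_append_zero_one {r : List (Fin 2)} (h : 1 ∈ r) :
    ∃ p q, 0 :: r = p ++ [0, 1] ++ q := by
  induction r with
  | nil => simp at h
  | cons i r ih =>
    rcases Fin.exists_fin_two.1 ⟨i, rfl⟩ with rfl | rfl
    · obtain ⟨p, q, e⟩ := ih (by simpa using h)
      exact ⟨0 :: p, q, by simp [e]⟩
    · exact ⟨[], r, by simp⟩

/-- Doubling is needed: in a word such as `[1, 0]`, the pattern `0, 1` only appears cyclically. -/
theorem exists_square_eq_append {l : List (Fin 2)} (h0 : 0 ∈ l) (h1 : 1 ∈ l) :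
    ∃ p q, l ++ l = p ++ [0, 1] ++ q := by
  obtain ⟨a, b, e⟩ := List.append_of_mem h0
  obtain ⟨p, q, e'⟩ := exists_append_zero_one (r := b ++ l) (List.mem_append_right _ h1)
  refine ⟨a ++ p, q, ?_⟩
  nth_rw 1 [e]
  rw [List.append_assoc, List.cons_append, e']
  simp

theorem norm_sq_le_of_mem_spectrum_burauWord {t : ℝ} (h0 : 0 ≤ t) (h1 : t ≤ 1)
    {l : List (Fin 2)} (hl0 : 0 ∈ l) (hl1 : 1 ∈ l) {z : ℂ}
    (hz : z ∈ spectrum ℂ (burauWord (t : ℂ) l)) : ‖z‖ ^ 2 ≤ t := by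
  obtain ⟨v, hv, e⟩ := exists_vecMul_of_mem_spectrum hz
  obtain ⟨p, q, epq⟩ := exists_square_eq_append hl0 hl1
  have e2 : hexNorm (Matrix.vecMul v (burauWord (t : ℂ) (l ++ l))) = ‖z‖ ^ 2 * hexNorm v := by
    rw [burauWord_append, ← Matrix.vecMul_vecMul, e, Matrix.smul_vecMul, e, hexNorm_smul,
      hexNorm_smul, pow_two, mul_assoc]
  rw [epq, burauWord_append, burauWord_append, ← Matrix.vecMul_vecMul,
    ← Matrix.vecMul_vecMul] at e2
  have h3 := hexNorm_vecMul_burauWord_le h0 h1 q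
    (Matrix.vecMul (Matrix.vecMul v (burauWord (t : ℂ) p)) (burauWord (t : ℂ) [0, 1]))
  rw [e2, hexNorm_vecMul_burauWord_zero_one h0] at h3
  exact le_of_mul_le_mul_right
    (h3.trans (mul_le_mul_of_nonneg_left (hexNorm_vecMul_burauWord_le h0 h1 p v) h0))
    (hexNorm_pos hv)

/-! ### The underlying permutation -/

/-- The transposition of a generator. -/
def genPerm (i : Fin 2) : Equiv.Perm (Fin 3) :=
  if i = 0 then Equiv.swap 0 1 else Equiv.swap 1 2

/-- The homomorphism from the braid group to the symmetric group. -/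
def braidPerm : Braid3 →* Equiv.Perm (Fin 3) :=
  PresentedGroup.toGroup (rels := braidRels) (f := genPerm) (by
    intro r hr
    rw [braidRels, Set.mem_singleton_iff] at hr
    subst hr
    simp only [map_mul, map_inv, FreeGroup.lift_apply_of]
    decide)

theorem braidPerm_braidGen (i : Fin 2) : braidPerm (braidGen i) = genPerm i := by
  rw [braidPerm, braidGen, PresentedGroup.toGroup.of]

/-- The reduced permutation representation, in the basis of the Burau matrices. -/
def reducedPerm (p : Equiv.Perm (Fin 3)) : Matrix (Fin 2) (Fin 2) ℤ :=
  -- The inverse makes `p ↦ e` multiplicative in this order. The two rows below are the differences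
  -- of `e₀` and `e₀ + e₁` times this matrix, since these triples lift the basis `(1, 0)`, `(0, 1)`.
  let e (i j : Fin 3) : ℤ := if p.symm i = j then 1 else 0
  !![e 0 0 - e 0 1, e 0 1 - e 0 2;
    e 0 0 - e 0 1 + (e 1 0 - e 1 1), e 0 1 - e 0 2 + (e 1 1 - e 1 2)]

theorem reducedPerm_one : reducedPerm 1 = 1 := by decide

theorem reducedPerm_genPerm_mul :
    ∀ (i : Fin 2) (p : Equiv.Perm (Fin 3)),
      reducedPerm (genPerm i * p) = burauMat 1 i * reducedPerm p := by
  decide +kernel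

theorem burauWord_one (l : List (Fin 2)) :
    burauWord (1 : ℤ) l = reducedPerm (braidPerm (l.map braidGen).prod) := by
  induction l with
  | nil => simp [burauWord, reducedPerm_one]
  | cons i l ih =>
    rw [burauWord_cons, ih, List.map_cons, List.prod_cons, map_mul, braidPerm_braidGen,
      reducedPerm_genPerm_mul]

/-- The full permutation matrix has trace the number of fixed points, here `0`; dividing out the
constant triples removes `1`. -/
theorem trace_reducedPerm :
    ∀ p : Equiv.Perm (Fin 3), (∀ i, p i ≠ i) → (reducedPerm p).trace = -1 := by
  decide +kernel

theorem sign_braidPerm (l : List (Fin 2)) :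
    Equiv.Perm.sign (braidPerm (l.map braidGen).prod) = (-1) ^ l.length := by
  induction l with
  | nil => simp
  | cons i l ih =>
    rw [List.map_cons, List.prod_cons, map_mul, map_mul, ih, braidPerm_braidGen,
      List.length_cons, pow_succ']
    congr 1
    revert i
    decide

theorem sign_of_forall_ne :
    ∀ p : Equiv.Perm (Fin 3), (∀ i, p i ≠ i) → Equiv.Perm.sign p = 1 := by
  decide

theorem braidPerm_apply_eq {l : List (Fin 2)} {k : Fin 3} (h : ∀ i ∈ l, genPerm i k = k) :
    braidPerm (l.map braidGen).prod k = k := by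
  induction l with
  | nil => simp
  | cons i l ih =>
    rw [List.map_cons, List.prod_cons, map_mul, Equiv.Perm.mul_apply,
      ih fun j hj => h j (List.mem_cons_of_mem _ hj), braidPerm_braidGen, h i (by simp)]

theorem zero_mem_and_one_mem {l : List (Fin 2)}
    (h : ∀ k, braidPerm (l.map braidGen).prod k ≠ k) : 0 ∈ l ∧ 1 ∈ l := by
  constructor
  · by_contra hl
    refine h 0 (braidPerm_apply_eq fun i hi => ?_)
    have : i ≠ 0 := fun e => hl (e ▸ hi)
    clear hi
    revert i
    decide
  · by_contra hl
    refine h 2 (braidPerm_apply_eq fun i hi => ?_)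
    have : i ≠ 1 := fun e => hl (e ▸ hi)
    clear hi
    revert i
    decide

/-! ### The spectral radius near `t = 1` -/

theorem exists_norm_eq_of_mem_spectrum {l : List (Fin 2)}
    (h : ∀ k, braidPerm (l.map braidGen).prod k ≠ k) :
    ∃ ε : ℝ, 0 < ε ∧ ∀ t : ℝ, t ∈ Set.Ioo (1 - ε) (1 + ε) → 0 < t ∧
      ∀ z ∈ spectrum ℂ (burauWord (t : ℂ) l), ‖z‖ = √(t ^ l.length) := by
  have heven : Even l.length := by
    have := sign_braidPerm l
    rw [sign_of_forall_ne _ h] at this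
    by_contra ho
    rw [(Nat.not_even_iff_odd.1 ho).neg_one_pow] at this
    revert this
    decide
  let τ : Polynomial ℤ := (burauWord Polynomial.X l).trace
  have hτ {R : Type} [CommRing R] (t : R) :
      (burauWord t l).trace = Polynomial.eval₂ (Int.castRingHom R) t τ := by
    have := burauWord_map (Polynomial.eval₂RingHom (Int.castRingHom R) t) Polynomial.X l
    rw [Polynomial.coe_eval₂RingHom, Polynomial.eval₂_X] at this
    rw [← this, Matrix.trace_fin_two, Matrix.map_apply, Matrix.map_apply,
      ← Polynomial.eval₂_add, ← Matrix.trace_fin_two]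
  have htr : (burauWord (1 : ℝ) l).trace = -1 := by
    have := burauWord_map (Int.castRingHom ℝ) 1 l
    rw [map_one] at this
    rw [← this, burauWord_one, Matrix.trace_fin_two, Matrix.map_apply, Matrix.map_apply,
      ← map_add, ← Matrix.trace_fin_two, trace_reducedPerm _ h]
    simp
  have hcont : Continuous fun t : ℝ => (burauWord t l).trace ^ 2 - 4 * t ^ l.length := by
    simp only [hτ]
    simp only [Polynomial.eval₂_eq_eval_map]
    fun_prop
  have hev : ∀ᶠ t in nhds (1 : ℝ), (burauWord t l).trace ^ 2 - 4 * t ^ l.length < 0 ∧ 0 < t := by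
    refine (hcont.continuousAt.eventually_lt continuousAt_const ?_).and
      (lt_mem_nhds one_pos)
    -- At `t = 1` the discriminant is `1 - 4 < 0`.
    rw [htr]
    norm_num
  obtain ⟨ε, hε, hball⟩ := Metric.eventually_nhds_iff_ball.1 hev
  refine ⟨ε, hε, fun t ht => ?_⟩
  obtain ⟨h1, h2⟩ := hball t (by rwa [Real.ball_eq_Ioo])
  refine ⟨h2, fun z hz => ?_⟩
  refine norm_of_quadratic (a := (burauWord t l).trace) ?_ (by linarith)
  have hz' := charpoly_of_mem_spectrum hz
  rw [det_burauWord, heven.neg_pow] at hz'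
  have e : (burauWord (t : ℂ) l).trace = ((burauWord t l).trace : ℂ) := by
    have := burauWord_map Complex.ofRealHom t l
    rw [Complex.ofRealHom_eq_coe] at this
    rw [← this, Matrix.trace_fin_two, Matrix.trace_fin_two]
    simp
  rw [e] at hz'
  rw [← hz']
  push_cast
  rfl

/-! ### The strands of a geometric braid -/

/-- The unit complex number that describes the half turn of a geometric crossing. -/
def crossingTurn (b : Bool) (x : ℝ) : ℂ :=
  Complex.exp ((if b then 1 else -1) * (Real.pi * Real.smoothTransition x : ℝ) * Complex.I)

/-- The strand of a geometric crossing that starts at the given position. -/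
def crossingPath (a : Fin 2 × Bool) (i : Fin 3) (x : ℝ) : ℂ :=
  if a.1 = 0 then ![3 / 2 - crossingTurn a.2 x / 2, 3 / 2 + crossingTurn a.2 x / 2, 3] i
  else ![1, 5 / 2 - crossingTurn a.2 x / 2, 5 / 2 + crossingTurn a.2 x / 2] i

/-- The endpoints of the strands. -/
def strandPos : Fin 3 → ℂ := ![1, 2, 3]

theorem continuous_crossingTurn (b : Bool) : Continuous (crossingTurn b) := by
  have := Real.smoothTransition.continuous
  unfold crossingTurn
  fun_prop

theorem norm_crossingTurn (b : Bool) (x : ℝ) : ‖crossingTurn b x‖ = 1 := by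
  rw [crossingTurn]
  cases b
  · convert Complex.norm_exp_ofReal_mul_I (-(Real.pi * Real.smoothTransition x)) using 4
    simp
  · convert Complex.norm_exp_ofReal_mul_I (Real.pi * Real.smoothTransition x) using 4
    simp

theorem crossingTurn_of_nonpos (b : Bool) {x : ℝ} (hx : x ≤ 0) : crossingTurn b x = 1 := by
  simp [crossingTurn, Real.smoothTransition.zero_of_nonpos hx]

theorem crossingTurn_of_one_le (b : Bool) {x : ℝ} (hx : 1 ≤ x) : crossingTurn b x = -1 := by
  cases b <;> simp [crossingTurn, Real.smoothTransition.one_of_one_le hx, Complex.exp_neg]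

theorem continuous_crossingPath (a : Fin 2 × Bool) (i : Fin 3) :
    Continuous (crossingPath a i) := by
  have := continuous_crossingTurn a.2
  unfold crossingPath
  split_ifs <;> fin_cases i <;> simp <;> fun_prop

theorem crossingPath_of_nonpos (a : Fin 2 × Bool) (i : Fin 3) {x : ℝ} (hx : x ≤ 0) :
    crossingPath a i x = strandPos i := by
  rw [crossingPath, crossingTurn_of_nonpos _ hx]
  split_ifs <;> fin_cases i <;> simp [strandPos] <;> norm_num

theorem crossingPath_of_one_le (a : Fin 2 × Bool) (i : Fin 3) {x : ℝ} (hx : 1 ≤ x) :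
    crossingPath a i x = strandPos (genPerm a.1 i) := by
  rw [crossingPath, crossingTurn_of_one_le _ hx, genPerm]
  split_ifs <;> fin_cases i <;> simp [strandPos, Equiv.swap_apply_def] <;> norm_num

theorem range_crossingPath (a : Fin 2 × Bool) (x : ℝ) :
    Set.range (fun i => crossingPath a i x) = crossingSlice a x := by
  ext p
  simp only [Set.mem_range, Fin.exists_fin_succ, crossingPath, crossingSlice, crossingTurn]
  split_ifs <;> simp [eq_comm]

theorem injective_crossingPath (a : Fin 2 × Bool) (x : ℝ) :
    Function.Injective (fun i => crossingPath a i x) := by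
  have hu := norm_crossingTurn a.2 x
  generalize h : crossingTurn a.2 x = u at hu
  -- The turning points coincide only for `u = 0`, and one of them meets the fixed strand only for
  -- `u = ±3`; all contradict `‖u‖ = 1`.
  have h0 : u ≠ 0 := by
    rintro rfl
    simp at hu
  have h3 : u ≠ 3 := by
    rintro rfl
    simp at hu
  have h3' : u ≠ -3 := by
    rintro rfl
    simp at hu
  intro i j hij
  simp only [crossingPath, h] at hij
  split_ifs at hij <;> fin_cases i <;> fin_cases j <;> simp at hij ⊢ <;> grind

theorem norm_crossingPath_lt (a : Fin 2 × Bool) (i : Fin 3) (x : ℝ) :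
    ‖crossingPath a i x‖ < 4 := by
  have hu : ‖crossingTurn a.2 x / 2‖ = 1 / 2 := by simp [norm_crossingTurn]
  have key (c : ℂ) (hc : ‖c‖ ≤ 3) :
      ‖c - crossingTurn a.2 x / 2‖ < 4 ∧ ‖c + crossingTurn a.2 x / 2‖ < 4 := by
    have h1 := norm_sub_le c (crossingTurn a.2 x / 2)
    have h2 := norm_add_le c (crossingTurn a.2 x / 2)
    constructor <;> linarith
  have k1 := key (3 / 2) (by norm_num)
  have k2 := key (5 / 2) (by norm_num)
  rw [crossingPath]
  split_ifs <;> fin_cases i <;> simp [k1, k2] <;> norm_num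

/-- The final position of the strand of a braid word with the given initial position. -/
def strandEnd : List (Fin 2 × Bool) → Fin 3 → Fin 3
  | [], i => i
  | a :: l, i => strandEnd l (genPerm a.1 i)

/-- The strand of the geometric braid with the given initial position. -/
def strand : List (Fin 2 × Bool) → Fin 3 → ℝ → ℂ
  | [], i, _ => strandPos i
  | a :: l, i, s =>
    crossingPath a i s + strand l (genPerm a.1 i) (s - 1) - strandPos (genPerm a.1 i)

/-- No gluing is required: `strand` is a sum of globally defined paths, where the crossing is
constant after height `1` and the tail is constant before it, and the subtracted endpoint cancels
the constant one. -/
theorem continuous_strand (l : List (Fin 2 × Bool)) (i : Fin 3) : Continuous (strand l i) := by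
  induction l generalizing i with
  | nil => exact continuous_const
  | cons a l ih =>
    exact ((continuous_crossingPath a i).add
      ((ih (genPerm a.1 i)).comp (continuous_id.sub continuous_const))).sub continuous_const

theorem strand_of_nonpos (l : List (Fin 2 × Bool)) (i : Fin 3) {s : ℝ} (hs : s ≤ 0) :
    strand l i s = strandPos i := by
  induction l generalizing i s with
  | nil => rfl
  | cons a l ih =>
    rw [strand, crossingPath_of_nonpos a i hs, ih _ (by linarith), add_sub_cancel_right]

theorem strand_cons_of_le_one (a : Fin 2 × Bool) (l : List (Fin 2 × Bool)) (i : Fin 3) {s : ℝ}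
    (hs : s ≤ 1) : strand (a :: l) i s = crossingPath a i s := by
  rw [strand, strand_of_nonpos _ _ (by linarith), add_sub_cancel_right]

theorem strand_cons_of_one_le (a : Fin 2 × Bool) (l : List (Fin 2 × Bool)) (i : Fin 3) {s : ℝ}
    (hs : 1 ≤ s) : strand (a :: l) i s = strand l (genPerm a.1 i) (s - 1) := by
  rw [strand, crossingPath_of_one_le a i hs, add_sub_cancel_left]

theorem strand_of_length_le (l : List (Fin 2 × Bool)) (i : Fin 3) {s : ℝ} (hs : l.length ≤ s) :
    strand l i s = strandPos (strandEnd l i) := by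
  induction l generalizing i s with
  | nil => rfl
  | cons a l ih =>
    rw [List.length_cons, Nat.cast_add, Nat.cast_one] at hs
    rw [strand_cons_of_one_le, ih _ (by linarith), strandEnd]
    linarith [l.length.cast_nonneg (α := ℝ)]

theorem injective_strandPos : Function.Injective strandPos := by
  intro i j hij
  fin_cases i <;> fin_cases j <;> simp [strandPos] at hij ⊢

theorem injective_strand (l : List (Fin 2 × Bool)) (s : ℝ) :
    Function.Injective (fun i => strand l i s) := by
  induction l generalizing s with
  | nil => exact injective_strandPos
  | cons a l ih =>
    rcases le_total s 1 with hs | hs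
    · simp only [strand_cons_of_le_one _ _ _ hs]
      exact injective_crossingPath a s
    · simp only [strand_cons_of_one_le _ _ _ hs]
      exact (ih (s - 1)).comp (genPerm a.1).injective

theorem norm_strand_lt (l : List (Fin 2 × Bool)) (i : Fin 3) (s : ℝ) : ‖strand l i s‖ < 4 := by
  induction l generalizing i s with
  | nil =>
    rw [strand]
    fin_cases i <;> simp [strandPos] <;> norm_num
  | cons a l ih =>
    rcases le_total s 1 with hs | hs
    · rw [strand_cons_of_le_one _ _ _ hs]
      exact norm_crossingPath_lt a i s
    · rw [strand_cons_of_one_le _ _ _ hs]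
      exact ih _ _

theorem range_strand (l : List (Fin 2 × Bool)) {s : ℝ} (hs : 0 ≤ s) :
    Set.range (fun i => strand l i s) = braidSlice l s := by
  induction l generalizing s with
  | nil =>
    ext p
    simp only [strand, strandPos, Set.mem_range, Fin.exists_fin_succ, braidSlice,
      List.getElem?_nil]
    simp [eq_comm]
  | cons a l ih =>
    rcases lt_or_ge s 1 with h | h
    · simp only [strand_cons_of_le_one _ _ _ h.le]
      rw [range_crossingPath, braidSlice, Nat.floor_eq_zero.2 h, List.getElem?_cons_zero,
        Int.fract_eq_self.2 ⟨hs, h⟩]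
    · simp only [strand_cons_of_one_le _ _ _ h]
      have e : ⌊s⌋₊ = ⌊s - 1⌋₊ + 1 := by
        rw [← Nat.floor_add_one (by linarith), sub_add_cancel]
      have : braidSlice (a :: l) s = braidSlice l (s - 1) := by
        rw [braidSlice, braidSlice, e, List.getElem?_cons_succ, Int.fract_sub_one]
      rw [this, ← ih (by linarith)]
      exact (genPerm a.1).surjective.range_comp (fun i => strand l i (s - 1))

/-! ### Components of a closed braid -/

/-- The embedding of the solid torus, on a strand of the geometric braid. -/
def strandCurve (l : List (Fin 2 × Bool)) (i : Fin 3) (s : ℝ) : EuclideanSpace ℂ (Fin 2) :=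
  !₂[strand l i s / 4, (Real.sqrt (1 - ‖strand l i s / 4‖ ^ 2) : ℂ) *
    Complex.exp ((2 * Real.pi * s / (l.length + 1) : ℝ) * Complex.I)]

/-- The part of the closed braid that is swept out by one strand. -/
def strandImage (l : List (Fin 2 × Bool)) (i : Fin 3) : Set (EuclideanSpace ℂ (Fin 2)) :=
  strandCurve l i '' Set.Icc 0 (l.length + 1)

theorem isCompact_strandImage (l : List (Fin 2 × Bool)) (i : Fin 3) :
    IsCompact (strandImage l i) := by
  refine isCompact_Icc.image ?_
  have := continuous_strand l i
  unfold strandCurve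
  refine (PiLp.continuous_toLp 2 _).comp (continuous_pi fun j => ?_)
  fin_cases j <;> simp <;> fun_prop

theorem closedBraid_eq_iUnion (l : List (Fin 2 × Bool)) :
    closedBraid l = ⋃ i, strandImage l i := by
  ext P
  simp only [closedBraid, Set.mem_ofPred_eq, Set.mem_iUnion, strandImage, Set.mem_image]
  constructor
  · rintro ⟨s, hs, p, hp, rfl⟩
    rw [← range_strand l hs.1] at hp
    obtain ⟨i, rfl⟩ := hp
    exact ⟨i, s, hs, rfl⟩
  · rintro ⟨i, s, hs, rfl⟩
    refine ⟨s, hs, strand l i s, ?_, rfl⟩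
    rw [← range_strand l hs.1]
    exact ⟨i, rfl⟩

/-- Equal angles differ by a whole number of turns, so `s - s'` is `-L`, `0` or `L`. -/
theorem eq_or_endpoints_of_exp_eq {L s s' : ℝ} (hL : 0 < L) (hs : s ∈ Set.Icc 0 L)
    (hs' : s' ∈ Set.Icc 0 L)
    (h : Complex.exp ((2 * Real.pi * s / L : ℝ) * Complex.I) =
      Complex.exp ((2 * Real.pi * s' / L : ℝ) * Complex.I)) :
    s = s' ∨ (s = 0 ∧ s' = L) ∨ (s = L ∧ s' = 0) := by
  obtain ⟨n, hn⟩ := Complex.exp_eq_exp_iff_exists_int.1 h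
  have e : s = s' + n * L := by
    have h1 : ((2 * Real.pi * s / L : ℝ) : ℂ) = (2 * Real.pi * s' / L + n * (2 * Real.pi) : ℝ) := by
      apply mul_right_cancel₀ Complex.I_ne_zero
      rw [hn]
      push_cast
      ring
    have h2 := Complex.ofReal_injective h1
    field_simp at h2
    linarith
  obtain ⟨a, b⟩ := hs
  obtain ⟨a', b'⟩ := hs'
  have n1 : n < 2 := by
    by_contra! hn2
    have : (2 : ℝ) ≤ n := by exact_mod_cast hn2
    nlinarith
  have n2 : -2 < n := by
    by_contra! hn2
    have : (n : ℝ) ≤ -2 := by exact_mod_cast hn2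
    nlinarith
  interval_cases n
  · refine Or.inr (Or.inl ?_)
    push_cast at e
    constructor <;> linarith
  · left
    simpa using e
  · refine Or.inr (Or.inr ?_)
    push_cast at e
    constructor <;> linarith

theorem disjoint_strandImage {l : List (Fin 2 × Bool)} {i j : Fin 3} (hi : strandEnd l i = i)
    (hinj : Function.Injective (strandEnd l)) (hij : j ≠ i) :
    Disjoint (strandImage l i) (strandImage l j) := by
  rw [Set.disjoint_left]
  rintro _ ⟨s, hs, rfl⟩ ⟨s', hs', h⟩
  have hL : (0 : ℝ) < l.length + 1 := by positivity
  have e0 : strand l j s' = strand l i s := by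
    have := congrFun (congrArg WithLp.ofLp h) 0
    simpa [strandCurve] using this
  have e1 := congrFun (congrArg WithLp.ofLp h) 1
  simp only [strandCurve, e0] at e1
  -- Strands stay strictly inside the solid torus, so the second coordinate determines the angle.
  have hpos : 0 < √(1 - ‖strand l i s / 4‖ ^ 2) := by
    have : ‖strand l i s / 4‖ < 1 := by
      rw [norm_div]
      norm_num
      linarith [norm_strand_lt l i s]
    rw [Real.sqrt_pos]
    nlinarith [norm_nonneg (strand l i s / 4)]
  have e2 := mul_left_cancel₀ (Complex.ofReal_ne_zero.2 hpos.ne') e1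
  rcases eq_or_endpoints_of_exp_eq hL hs' hs e2 with rfl | ⟨rfl, rfl⟩ | ⟨rfl, rfl⟩
  · exact hij (injective_strand l _ e0)
  · rw [strand_of_nonpos l j le_rfl, strand_of_length_le l i (by linarith), hi] at e0
    exact hij (injective_strandPos e0)
  · rw [strand_of_nonpos l i le_rfl, strand_of_length_le l j (by linarith)] at e0
    exact hij (hinj ((injective_strandPos e0).trans hi.symm))

theorem IsKnot.isPreconnected {K : Set (EuclideanSpace ℂ (Fin 2))} (h : IsKnot K) :
    IsPreconnected K := by
  obtain ⟨γ, hγ, -, -, -, rfl⟩ := h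
  exact isPreconnected_range hγ.continuous

/-- A strand ending where it began would split the connected closure into two disjoint nonempty
closed sets: its own image and the union of the other two. -/
theorem strandEnd_ne_of_isKnot {l : List (Fin 2 × Bool)} (h : IsKnot (closedBraid l))
    (hinj : Function.Injective (strandEnd l)) (i : Fin 3) : strandEnd l i ≠ i := by
  intro hi
  have hne (j : Fin 3) : (strandImage l j).Nonempty :=
    ⟨_, 0, ⟨le_rfl, by positivity⟩, rfl⟩
  have hc := isPreconnected_closed_iff.1 h.isPreconnected (strandImage l i)
    (⋃ j ∈ ({i}ᶜ : Set (Fin 3)), strandImage l j) (isCompact_strandImage l i).isClosed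
    ((Set.toFinite _).isClosed_biUnion fun j _ => (isCompact_strandImage l j).isClosed)
  rw [closedBraid_eq_iUnion] at hc
  obtain ⟨k, hk⟩ := exists_ne i
  obtain ⟨P, hP⟩ := hne i
  obtain ⟨Q, hQ⟩ := hne k
  obtain ⟨R, -, hR1, hR2⟩ := hc
    (by
      intro x hx
      obtain ⟨j, hj⟩ := Set.mem_iUnion.1 hx
      by_cases e : j = i
      · exact Or.inl (e ▸ hj)
      · exact Or.inr (Set.mem_biUnion (x := j) e hj))
    ⟨P, Set.mem_iUnion.2 ⟨i, hP⟩, hP⟩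
    ⟨Q, Set.mem_iUnion.2 ⟨k, hQ⟩, Set.mem_biUnion (x := k) hk hQ⟩
  obtain ⟨j, hj, hR⟩ := Set.mem_iUnion₂.1 hR2
  exact Set.disjoint_left.1 (disjoint_strandImage hi hinj hj) hR1 hR

theorem braidPerm_mk (l : List (Fin 2 × Bool)) :
    braidPerm (PresentedGroup.mk braidRels (FreeGroup.mk l)) =
      (l.map fun a => genPerm a.1).prod := by
  have : braidPerm (PresentedGroup.mk braidRels (FreeGroup.mk l)) =
    FreeGroup.lift genPerm (FreeGroup.mk l) := rfl
  rw [this, FreeGroup.lift_mk]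
  -- Transpositions are involutions, so the sign of a letter does not matter.
  congr 2
  ext1 ⟨i, b⟩
  revert i b
  decide

/-- Following a strand applies the first letter first, while the product applies it last; hence
`strandEnd` is the inverse permutation, which is injective and has the same fixed points. -/
theorem prod_genPerm_strandEnd (l : List (Fin 2 × Bool)) (i : Fin 3) :
    (l.map fun a => genPerm a.1).prod (strandEnd l i) = i := by
  induction l generalizing i with
  | nil => rfl
  | cons a l ih =>
    rw [List.map_cons, List.prod_cons, Equiv.Perm.mul_apply, strandEnd, ih]
    generalize a.1 = k
    revert k i
    decide

/-- If the closure of a braid is a knot, its permutation has no fixed point. -/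
theorem ClosureIsKnot.braidPerm_ne {w : Braid3} (h : ClosureIsKnot w) (k : Fin 3) :
    braidPerm w k ≠ k := by
  obtain ⟨l, rfl, hl⟩ := h
  intro hk
  rw [braidPerm_mk] at hk
  refine strandEnd_ne_of_isKnot hl ?_ k ?_
  · exact Function.LeftInverse.injective (prod_genPerm_strandEnd l)
  · exact Equiv.injective _ ((prod_genPerm_strandEnd l k).trans hk.symm)

end

theorem mainTheorem7 (w : Braid3) (hpos : IsPositiveBraid w) (hknot : ClosureIsKnot w) :
    rho w 0 = 0 ∧ rho w 1 = 1 ∧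
    (∀ t : ℝ, t ∈ Set.Ico (0 : ℝ) 1 → rho w (t : ℂ) < 1) ∧
    ∃ ε : ℝ, 0 < ε ∧ ∀ t : ℝ, t ∈ Set.Ioo (1 - ε) (1 + ε) →
      rho w (t : ℂ) = t ^ ((exponentSum w : ℝ) / 2) := by
  obtain ⟨l, rfl⟩ := hpos.exists_word
  have hperm := hknot.braidPerm_ne
  obtain ⟨hl0, hl1⟩ := zero_mem_and_one_mem hperm
  have hle : ∀ t : ℝ, t ∈ Set.Icc (0 : ℝ) 1 → rho (l.map braidGen).prod (t : ℂ) ≤ √t := by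
    intro t ht
    rw [rho, burauAt_prod]
    refine toReal_spectralRadius_le (Real.sqrt_nonneg t) fun z hz => ?_
    exact Real.le_sqrt_of_sq_le
      (norm_sq_le_of_mem_spectrum_burauWord ht.1 ht.2 hl0 hl1 hz)
  obtain ⟨ε, hε, hnear⟩ := exists_norm_eq_of_mem_spectrum hperm
  have heq : ∀ t : ℝ, t ∈ Set.Ioo (1 - ε) (1 + ε) → rho (l.map braidGen).prod (t : ℂ) =
      t ^ ((exponentSum (l.map braidGen).prod : ℝ) / 2) := by
    intro t ht
    obtain ⟨ht0, hz⟩ := hnear t ht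
    rw [rho, burauAt_prod, toReal_spectralRadius_eq (Real.sqrt_nonneg _) hz, exponentSum_prod,
      Real.sqrt_eq_rpow, ← Real.rpow_natCast, ← Real.rpow_mul ht0.le, Int.cast_natCast,
      mul_one_div]
  refine ⟨?_, ?_, fun t ht => ?_, ε, hε, heq⟩
  · refine le_antisymm ?_ ENNReal.toReal_nonneg
    simpa using hle 0 (by simp)
  · simpa using heq 1 (by constructor <;> linarith)
  · refine (hle t ⟨ht.1, ht.2.le⟩).trans_lt ?_
    rw [Real.sqrt_lt' one_pos, one_pow]
    exact ht.2
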